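/- For $K\subseteq\mathbb R^n$ nonempty, convex and compact let $h_K(y)=\sup\{(x,y):x\in K\}$, and for $0\in K_0\cap K_1$ and $p\in(0,1)$ let $$\tfrac12\cdot K_0+_p\tfrac12\cdot K_1=\Big\{x\in\mathbb R^n:(x,y)\le\big(\tfrac12h_{K_0}(y)^p+\tfrac12h_{K_1}(y)^p\big)^{1/p}\ \text{ for all } y\in\mathbb S^{n-1}\Big\}.$$ Let $V_k$ be the $k$-th intrinsic volume, i.e. $\mathrm{vol}_n(K+rB_n)=\sum_{k=0}^n\kappa_{n-k}V_k(K)r^{n-k}$ for $r\ge0$, where $B_n$ is the unit ball of $\mathbb R^n$ and $\kappa_j=\mathrm{vol}_j(B_j)$. Let $\mathcal K^n_{0,s}$ be the family of origin-symmetric convex bodies in $\mathbb R^n$ with the origin in their interior. For $p\in(0,1)$ say that $K_0,K_1$ violate the $p$-Brunn–Minkowski inequality for $V_k$ if $$V_k\big(\tfrac12\cdot K_0+_p\tfrac12\cdot K_1\big)^{p/k}<\tfrac12V_k(K_0)^{p/k}+\tfrac12V_k(K_1)^{p/k}.$$ **Theorem.** Let $n\ge3$, $k\in\{2,\dots,n-1\}$,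 and set $$\bar p_k=\begin{cases}\dfrac{k}{\log_2\binom{2k}{k}}&\text{if }k\le\frac n2,\\[2mm]\dfrac1{\log_2\sum_{i=1}^k\binom{2(n-k)}{i}}&\text{if }\frac n2<k\le\frac{2n}3,\\[2mm]\dfrac1{\log_2\left(2^{2(n-k)}-1\right)}&\text{if }\frac{2n}3<k\le n-1.\end{cases}$$ 1. $\bar p_k\in(0,1)$, and for every $p\in(0,\bar p_k)$ the $p$-Brunn–Minkowski inequality for $V_k$ fails in $\mathcal K^n_{0,s}$. More precisely, for every $p\in(0,\bar p_k)$ there are $K_0,K_1\in\mathcal K^n_{0,s}$ that violate the $q$-Brunn–Minkowski inequality for $V_k$ for all $q\in(0,p]$. 2. Let $\hat p_k=\bar p_k$ if $k\le\frac n2$, and $\hat p_k=1/\log_2\binom nk$ if $k>\frac n2$. Then $\hat p_k\in(0,1)$, and for every $p\in(0,\hat p_k)$ the two $k$-dimensional coordinate cubes $C_0=\{0\}^{n-k}\times[-1,1]^k$ and $C_1=[-1,1]^k\times\{0\}^{n-k}$ violate the $p$-Brunn–Minkowski inequality for $V_k$. -/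

import Mathlib

open scoped Pointwise Polynomial

noncomputable section

namespace PBrunnMinkowski

/-- The support function `h_K(y) = sup {(x, y) : x ∈ K}`. -/
def supportFun {n : ℕ} (K : Set (EuclideanSpace ℝ (Fin n))) (y : EuclideanSpace ℝ (Fin n)) : ℝ :=
  sSup ((fun x => inner ℝ x y) '' K)

/-- The Aleksandrov body (Wulff shape) of a function on the unit sphere. -/
def wulffShape {n : ℕ} (f : EuclideanSpace ℝ (Fin n) → ℝ) : Set (EuclideanSpace ℝ (Fin n)) :=
  {x | ∀ y : EuclideanSpace ℝ (Fin n), ‖y‖ = 1 → inner ℝ x y ≤ f y}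

/-- The `L^p` Minkowski convex combination `(1-t) · K₀ +_p t · K₁`, for `p > 0` and `t ∈ [0,1]`:
the Wulff shape of `((1-t) h_{K₀}^p + t h_{K₁}^p)^{1/p}`. -/
def pCombination {n : ℕ} (p t : ℝ) (K₀ K₁ : Set (EuclideanSpace ℝ (Fin n))) :
    Set (EuclideanSpace ℝ (Fin n)) :=
  wulffShape fun y => ((1 - t) * supportFun K₀ y ^ p + t * supportFun K₁ y ^ p) ^ (1 / p)

/-- `κ_j`, the volume of the unit ball of `ℝ^j` (with `κ_0 = 1`). -/
def unitBallVolume (j : ℕ) : ℝ :=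
  MeasureTheory.volume.real (Metric.closedBall (0 : EuclideanSpace ℝ (Fin j)) 1)

/-- `P` is the polynomial `r ↦ vol_n (K + r B_n)`, `r ≥ 0`. -/
def IsSteinerPolynomial {n : ℕ} (K : Set (EuclideanSpace ℝ (Fin n))) (P : ℝ[X]) : Prop :=
  ∀ r : ℝ, 0 ≤ r →
    MeasureTheory.volume.real (K + Metric.closedBall (0 : EuclideanSpace ℝ (Fin n)) r) = P.eval r

theorem IsSteinerPolynomial.unique {n : ℕ} {K : Set (EuclideanSpace ℝ (Fin n))} {P Q : ℝ[X]}
    (hP : IsSteinerPolynomial K P) (hQ : IsSteinerPolynomial K Q) : P = Q := by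
  refine Polynomial.eq_of_infinite_eval_eq P Q ((Set.Ici_infinite (0 : ℝ)).mono fun r hr => ?_)
  exact (hP r hr).symm.trans (hQ r hr)

open Classical in
/-- The `k`-th intrinsic volume `V_k(K)` (`0 ≤ k ≤ n`), defined by the Steiner formula
`vol_n (K + r B_n) = ∑_{k=0}^n κ_{n-k} V_k(K) r^{n-k}` for `r ≥ 0`. Every convex body has such a
polynomial, which is unique; the value `0` is only given to sets without one. -/
def intrinsicVolume {n : ℕ} (k : ℕ) (K : Set (EuclideanSpace ℝ (Fin n))) : ℝ :=
  if h : ∃ P : ℝ[X], IsSteinerPolynomial K P then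
    h.choose.coeff (n - k) / unitBallVolume (n - k)
  else 0

theorem intrinsicVolume_eq {n : ℕ} (k : ℕ) {K : Set (EuclideanSpace ℝ (Fin n))} {P : ℝ[X]}
    (hP : IsSteinerPolynomial K P) :
    intrinsicVolume k K = P.coeff (n - k) / unitBallVolume (n - k) := by
  have h : ∃ P : ℝ[X], IsSteinerPolynomial K P := ⟨P, hP⟩
  rw [intrinsicVolume, dif_pos h, h.choose_spec.unique hP]

/-- The class of origin-symmetric convex bodies of `ℝ^n` with the origin in their interior. -/
def IsSymmetricBody {n : ℕ} (K : ConvexBody (EuclideanSpace ℝ (Fin n))) : Prop :=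
  (0 : EuclideanSpace ℝ (Fin n)) ∈ interior (K : Set (EuclideanSpace ℝ (Fin n))) ∧
    ∀ x ∈ K, -x ∈ K

/-- The `p`-Brunn-Minkowski inequality for `V_k` is violated by `K₀`, `K₁` at `t = 1/2`. -/
def ViolatesPBM {n : ℕ} (k : ℕ) (p : ℝ) (K₀ K₁ : Set (EuclideanSpace ℝ (Fin n))) : Prop :=
  intrinsicVolume k (pCombination p (1 / 2) K₀ K₁) ^ (p / k) <
    1 / 2 * intrinsicVolume k K₀ ^ (p / k) + 1 / 2 * intrinsicVolume k K₁ ^ (p / k)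

/-- The `k`-dimensional cube of side `2` in the span of the last `k` coordinate vectors. -/
def lastCube (n k : ℕ) : Set (EuclideanSpace ℝ (Fin n)) :=
  {x | ∀ i : Fin n, ((i : ℕ) < n - k → x i = 0) ∧ (n - k ≤ (i : ℕ) → |x i| ≤ 1)}

/-- The `k`-dimensional cube of side `2` in the span of the first `k` coordinate vectors. -/
def firstCube (n k : ℕ) : Set (EuclideanSpace ℝ (Fin n)) :=
  {x | ∀ i : Fin n, ((i : ℕ) < k → |x i| ≤ 1) ∧ (k ≤ (i : ℕ) → x i = 0)}

/-- The explicit threshold for `2 ≤ k ≤ n - 1`, in the cases `k ≤ n/2`, `n/2 < k ≤ 2n/3` and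
`2n/3 < k ≤ n - 1`. -/
def pBar (n k : ℕ) : ℝ :=
  if 2 * k ≤ n then k / Real.logb 2 ((2 * k).choose k : ℝ)
  else if 3 * k ≤ 2 * n then
    1 / Real.logb 2 (∑ i ∈ Finset.Icc 1 k, ((2 * (n - k)).choose i : ℝ))
  else 1 / Real.logb 2 (2 ^ (2 * (n - k)) - 1 : ℝ)

/-- A threshold below which the two coordinate cubes violate the inequality; it equals `pBar n k`
for `k ≤ n/2`. -/
def pCube (n k : ℕ) : ℝ :=
  if 2 * k ≤ n then pBar n k else 1 / Real.logb 2 (n.choose k : ℝ)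

end PBrunnMinkowski

end

noncomputable section

namespace PBrunnMinkowski

open MeasureTheory

/-! Everything is tested on boxes `∏ [-a_i, a_i]`, possibly degenerate. There `V_k = 2^k e_k(a)`,
with `e_k` the elementary symmetric polynomial (`intrinsicVolume_box`), and for `p ≤ 1` the
`p`-combination of two boxes is the box of coordinatewise power means (`pCombination_box`). A
violation therefore follows once `e_k` of the power means is smaller than both `e_k(a)` and
`e_k(b)`. Power means increase with the exponent, so the same pair serves every `q ≤ p`.

Put `s = 2^(-1/p)`, the power mean of `0` and `1`. If `2k ≤ n`, the two cubes have disjoint supports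
and the quantity to beat is `C(2k,k) s^k < 1`. If `2k > n`, put `m = n - k`, take half-width `1` on
the `2k - n` shared coordinates and `δ` on the others: each box has `e_k = δ^m`, while the power
means give `C(2m,m) s^m δ^m + O(δ^(m+1))`. Hence `C(2m,m) s^m < 1` suffices for small `δ`, and `p <
pBar n k` implies it (`exists_elemSymm_powerMean_radii_lt`). For the cubes themselves, where `δ =
1`, the cruder bound `C(n,k) s` is used.

Strict inequalities survive a small enlargement of all half-widths, which puts the origin in the
interior (`exists_symmetricBody_violatesPBM`). -/

/-! ### Steiner formula and intrinsic volumes of boxes. -/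

/-- The soft threshold: `x` minus its metric projection onto `[-w, w]`. -/
def softThreshold (w x : ℝ) : ℝ := max (x - w) (min (x + w) 0)

theorem measurable_softThreshold (w : ℝ) : Measurable (softThreshold w) := by
  unfold softThreshold
  fun_prop

theorem abs_softThreshold_le {w u v : ℝ} (hu : |u| ≤ w) : |softThreshold w (u + v)| ≤ |v| := by
  rw [abs_le] at hu
  unfold softThreshold
  grind

theorem abs_sub_softThreshold_le {w : ℝ} (hw : 0 ≤ w) (x : ℝ) : |x - softThreshold w x| ≤ w := by
  unfold softThreshold
  grind

/-- The interval `[-w, w]` collapses to an atom at `0`, and the two outer half-lines are translated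
until they meet there. -/
theorem map_softThreshold {w : ℝ} (hw : 0 ≤ w) :
    (volume : Measure ℝ).map (softThreshold w) =
      (2 * w).toNNReal • Measure.dirac (0 : ℝ) + volume := by
  have : IsLocallyFiniteMeasure ((2 * w).toNNReal • Measure.dirac (0 : ℝ) + volume) :=
    ⟨fun x => ⟨Metric.ball x 1, Metric.ball_mem_nhds x one_pos,
      ENNReal.add_lt_top.2 ⟨measure_lt_top _ _, measure_ball_lt_top⟩⟩⟩
  refine (Real.measure_ext_Ioo_rat fun a b => ?_).symm
  rw [Measure.map_apply (measurable_softThreshold w) measurableSet_Ioo]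
  generalize (a : ℝ) = a
  generalize (b : ℝ) = b
  simp only [Measure.add_apply, Measure.smul_apply, Real.volume_Ioo,
    Measure.dirac_apply' _ measurableSet_Ioo]
  rcases le_or_gt b a with hab | hab
  · rw [Set.Ioo_eq_empty (not_lt.2 hab)]
    simp [hab]
  by_cases ha : 0 ≤ a
  · have : softThreshold w ⁻¹' Set.Ioo a b = Set.Ioo (a + w) (b + w) := by
      ext x
      simp only [softThreshold, Set.mem_preimage, Set.mem_Ioo]
      grind
    rw [this, Real.volume_Ioo, Set.indicator_of_notMem (fun h => absurd h.1 (not_lt.2 ha))]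
    simp
  by_cases hb : b ≤ 0
  · have : softThreshold w ⁻¹' Set.Ioo a b = Set.Ioo (a - w) (b - w) := by
      ext x
      simp only [softThreshold, Set.mem_preimage, Set.mem_Ioo]
      grind
    rw [this, Real.volume_Ioo, Set.indicator_of_notMem (fun h => absurd h.2 (not_lt.2 hb))]
    simp
  · push Not at ha hb
    have : softThreshold w ⁻¹' Set.Ioo a b = Set.Ioo (a - w) (b + w) := by
      ext x
      simp only [softThreshold, Set.mem_preimage, Set.mem_Ioo]
      grind
    rw [this, Real.volume_Ioo, Set.indicator_of_mem (by exact ⟨ha, hb⟩)]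
    rw [Pi.one_apply, ENNReal.smul_def, smul_eq_mul, mul_one, ← ENNReal.ofReal,
      ← ENNReal.ofReal_add (by positivity) (by linarith)]
    congr 1
    ring

theorem unitBallVolume_pos (j : ℕ) : 0 < unitBallVolume j :=
  ENNReal.toReal_pos (Metric.measure_closedBall_pos _ _ one_pos).ne' measure_closedBall_lt_top.ne

theorem volume_closedBall_euclidean {ι : Type*} [Fintype ι] {r : ℝ} (hr : 0 ≤ r) :
    volume {x : ι → ℝ | ∑ i, x i ^ 2 ≤ r ^ 2} =
      ENNReal.ofReal (unitBallVolume (Fintype.card ι) * r ^ Fintype.card ι) := by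
  have h1 : volume {x : ι → ℝ | ∑ i, x i ^ 2 ≤ r ^ 2} =
      volume (Metric.closedBall (0 : EuclideanSpace ℝ ι) r) := by
    rw [EuclideanSpace.closedBall_zero_eq r hr,
      ← (PiLp.volume_preserving_ofLp ι).measure_preimage]
    · rfl
    · exact (measurableSet_le (by fun_prop) (by fun_prop)).nullMeasurableSet
  let e : EuclideanSpace ℝ (Fin (Fintype.card ι)) ≃ₗᵢ[ℝ] EuclideanSpace ℝ ι :=
    LinearIsometryEquiv.piLpCongrLeft 2 ℝ ℝ (Fintype.equivFin ι).symm
  have h2 : volume (Metric.closedBall (0 : EuclideanSpace ℝ ι) r) =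
      volume (Metric.closedBall (0 : EuclideanSpace ℝ (Fin (Fintype.card ι))) r) := by
    rw [← e.measurePreserving.measure_preimage measurableSet_closedBall.nullMeasurableSet,
      e.preimage_closedBall, map_zero]
  rw [h1, h2, Measure.addHaar_closedBall' _ _ hr, finrank_euclideanSpace_fin, mul_comm,
    ENNReal.ofReal_mul (unitBallVolume_pos _).le, unitBallVolume,
    ofReal_measureReal measure_closedBall_lt_top.ne]

/-- The Lebesgue measure of the coordinate subspace of vectors vanishing on `S`. -/
theorem pi_dirac_volume {ι : Type*} [Fintype ι] [DecidableEq ι] (S : Finset ι) (c : ι → NNReal) :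
    Measure.pi (fun i => if i ∈ S then c i • Measure.dirac (0 : ℝ) else volume) =
      (∏ i ∈ S, c i) • (volume : Measure ({i // i ∉ S} → ℝ)).map
        (fun y i => if h : i ∈ S then 0 else y ⟨i, h⟩) := by
  have : ∀ i, SigmaFinite (if i ∈ S then c i • Measure.dirac (0 : ℝ) else volume) := by
    intro i
    split_ifs <;> infer_instance
  have hmeas : Measurable (fun (y : {i // i ∉ S} → ℝ) (i : ι) =>
      if h : i ∈ S then 0 else y ⟨i, h⟩) := by
    refine measurable_pi_lambda _ fun i => ?_
    by_cases h : i ∈ S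
    · simp [h]
    · simpa [h] using measurable_pi_apply _
  refine Measure.pi_eq fun s hs => ?_
  rw [Measure.smul_apply, Measure.map_apply hmeas (MeasurableSet.univ_pi hs)]
  have hprod : ∏ i, (if i ∈ S then c i • Measure.dirac (0 : ℝ) else volume) (s i) =
      (∏ i ∈ S, (c i • Measure.dirac (0 : ℝ)) (s i)) * ∏ i : {i // i ∉ S}, volume (s i) := by
    rw [← Fintype.prod_subtype_mul_prod_subtype (· ∈ S),
      ← Finset.prod_coe_sort S fun i => (c i • Measure.dirac (0 : ℝ)) (s i)]
    congr 1
    · exact Finset.prod_congr (by ext; simp) fun i _ => by rw [if_pos i.2]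
    · exact Fintype.prod_congr _ _ fun i => by rw [if_neg i.2]
  rw [hprod]
  by_cases h0 : ∀ i ∈ S, (0 : ℝ) ∈ s i
  · have hpre : (fun (y : {i // i ∉ S} → ℝ) (i : ι) => if h : i ∈ S then 0 else y ⟨i, h⟩) ⁻¹'
        Set.univ.pi s = Set.univ.pi fun i : {i // i ∉ S} => s i := by
      ext y
      simp only [Set.mem_preimage, Set.mem_univ_pi]
      refine ⟨fun h i => by simpa [i.2] using h i, fun h i => ?_⟩
      by_cases hi : i ∈ S
      · simpa [hi] using h0 i hi
      · simpa [hi] using h ⟨i, hi⟩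
    rw [hpre, volume_pi_pi, ENNReal.smul_def, smul_eq_mul]
    congr 1
    push_cast
    refine Finset.prod_congr rfl fun i hi => ?_
    simp [Measure.dirac_apply' _ (hs i), h0 i hi, ENNReal.smul_def]
  · push Not at h0
    obtain ⟨i, hi, hi0⟩ := h0
    have hpre : (fun (y : {i // i ∉ S} → ℝ) (i : ι) => if h : i ∈ S then 0 else y ⟨i, h⟩) ⁻¹'
        Set.univ.pi s = ∅ := by
      ext y
      simp only [Set.mem_preimage, Set.mem_univ_pi, Set.mem_empty_iff_false, iff_false]
      intro h
      exact hi0 (by simpa [hi] using h i)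
    have h0 : (c i • Measure.dirac (0 : ℝ)) (s i) = 0 := by
      simp [Measure.dirac_apply' _ (hs i), hi0]
    rw [hpre, measure_empty, smul_zero, Finset.prod_eq_zero hi h0, zero_mul]

/-- Product measures are multilinear in their factors; `S` records the coordinates where the atom is
chosen. -/
theorem pi_smul_dirac_add_volume {ι : Type*} [Fintype ι] [DecidableEq ι] (c : ι → NNReal) :
    Measure.pi (fun i => c i • Measure.dirac (0 : ℝ) + volume) =
      ∑ S : Finset ι, Measure.pi
        (fun i => if i ∈ S then c i • Measure.dirac (0 : ℝ) else volume) := by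
  have : ∀ (S : Finset ι) (i : ι),
      SigmaFinite (if i ∈ S then c i • Measure.dirac (0 : ℝ) else volume) := by
    intro S i
    split_ifs <;> infer_instance
  refine Measure.pi_eq fun s hs => ?_
  simp only [Measure.finsetSum_apply, Measure.pi_pi, Measure.add_apply, Finset.prod_add,
    Finset.powerset_univ]
  refine Finset.sum_congr rfl fun S _ => ?_
  rw [← Finset.prod_mul_prod_compl S]
  congr 1
  · exact Finset.prod_congr rfl fun i hi => by simp [hi]
  · rw [Finset.compl_eq_univ_sdiff]
    exact Finset.prod_congr rfl fun i hi => by simp [(Finset.mem_sdiff.1 hi).2]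

/-- The box `∏ [-a_i, a_i]`. -/
def box {n : ℕ} (a : Fin n → ℝ) : Set (EuclideanSpace ℝ (Fin n)) := {x | ∀ i, |x i| ≤ a i}

/-- Metric projection onto a box acts coordinatewise, so the soft thresholds form the shortest
vector from the box to `x`. -/
theorem box_add_closedBall {n : ℕ} {a : Fin n → ℝ} (ha : ∀ i, 0 ≤ a i) {r : ℝ} (hr : 0 ≤ r) :
    box a + Metric.closedBall (0 : EuclideanSpace ℝ (Fin n)) r =
      {x | ∑ i, softThreshold (a i) (x i) ^ 2 ≤ r ^ 2} := by
  rw [EuclideanSpace.closedBall_zero_eq r hr]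
  ext x
  simp only [Set.mem_add, Set.mem_ofPred_eq, box]
  constructor
  · rintro ⟨u, hu, v, hv, rfl⟩
    refine le_trans (Finset.sum_le_sum fun i _ => ?_) hv
    exact sq_le_sq.2 (abs_softThreshold_le (hu i))
  · intro hx
    refine ⟨x - WithLp.toLp 2 (fun i => softThreshold (a i) (x i)), fun i => ?_,
      WithLp.toLp 2 (fun i => softThreshold (a i) (x i)), hx, sub_add_cancel _ _⟩
    exact abs_sub_softThreshold_le (ha i) _

/-- Soft thresholding turns the parallel body into the preimage of a ball. In the pushed-forward
measure, the coordinates in `S` contribute atoms of mass `2 a_i`, and the remaining ones a ball of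
dimension `n - |S|`. -/
theorem volume_box_add_closedBall {n : ℕ} {a : Fin n → ℝ} (ha : ∀ i, 0 ≤ a i) {r : ℝ}
    (hr : 0 ≤ r) :
    volume (box a + Metric.closedBall (0 : EuclideanSpace ℝ (Fin n)) r) =
      ENNReal.ofReal (∑ S : Finset (Fin n),
        (∏ i ∈ S, (2 * a i)) * unitBallVolume (n - S.card) * r ^ (n - S.card)) := by
  have hB : MeasurableSet {x : Fin n → ℝ | ∑ i, x i ^ 2 ≤ r ^ 2} :=
    measurableSet_le (by fun_prop) (by fun_prop)
  have hT : Measurable fun (x : Fin n → ℝ) i => softThreshold (a i) (x i) :=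
    measurable_pi_lambda _ fun i => (measurable_softThreshold _).comp (measurable_pi_apply i)
  have hσ : ∀ i, SigmaFinite ((volume : Measure ℝ).map (softThreshold (a i))) := fun i => by
    rw [map_softThreshold (ha i)]
    infer_instance
  have h1 : volume (box a + Metric.closedBall (0 : EuclideanSpace ℝ (Fin n)) r) =
      (volume : Measure (Fin n → ℝ)).map (fun x i => softThreshold (a i) (x i))
        {x | ∑ i, x i ^ 2 ≤ r ^ 2} := by
    rw [Measure.map_apply hT hB, box_add_closedBall ha hr,
      ← (PiLp.volume_preserving_ofLp (Fin n)).measure_preimage (hT hB).nullMeasurableSet]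
    rfl
  rw [h1, volume_pi, Measure.pi_map_pi fun i => (measurable_softThreshold (a i)).aemeasurable]
  simp only [map_softThreshold (ha _)]
  rw [pi_smul_dirac_add_volume, Measure.finsetSum_apply,
    ENNReal.ofReal_sum_of_nonneg fun S _ => mul_nonneg (mul_nonneg (Finset.prod_nonneg fun i _ =>
      mul_nonneg zero_le_two (ha i)) (unitBallVolume_pos _).le) (pow_nonneg hr _)]
  refine Finset.sum_congr rfl fun S _ => ?_
  have hmeas : Measurable (fun (y : {i // i ∉ S} → ℝ) (i : Fin n) =>
      if h : i ∈ S then 0 else y ⟨i, h⟩) := by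
    refine measurable_pi_lambda _ fun i => ?_
    by_cases h : i ∈ S
    · simp [h]
    · simpa [h] using measurable_pi_apply _
  have hpre : (fun (y : {i // i ∉ S} → ℝ) (i : Fin n) => if h : i ∈ S then 0 else y ⟨i, h⟩) ⁻¹'
      {x | ∑ i, x i ^ 2 ≤ r ^ 2} = {y | ∑ i, y i ^ 2 ≤ r ^ 2} := by
    ext y
    simp only [Set.mem_preimage, Set.mem_ofPred_eq]
    rw [← Fintype.sum_subtype_add_sum_subtype (· ∈ S), Finset.sum_eq_zero, zero_add]
    · exact (congrArg (· ≤ r ^ 2) (Finset.sum_congr rfl fun i _ => by rw [dif_neg i.2])).to_iff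
    · exact fun i _ => by rw [dif_pos i.2, zero_pow two_ne_zero]
  have hcard : Fintype.card {i // i ∉ S} = n - S.card := by simp
  rw [pi_dirac_volume, Measure.smul_apply, Measure.map_apply hmeas hB, hpre,
    volume_closedBall_euclidean hr, hcard, ENNReal.smul_def, smul_eq_mul, mul_assoc,
    ENNReal.ofReal_mul (Finset.prod_nonneg fun i _ => mul_nonneg zero_le_two (ha i))]
  congr 1
  rw [ENNReal.ofReal_prod_of_nonneg fun i _ => mul_nonneg zero_le_two (ha i)]
  push_cast
  rfl

/-- The elementary symmetric polynomial of degree `k`. -/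
def elemSymm {n : ℕ} (k : ℕ) (a : Fin n → ℝ) : ℝ :=
  ∑ S ∈ Finset.powersetCard k Finset.univ, ∏ i ∈ S, a i

theorem intrinsicVolume_box {n k : ℕ} (hk : k ≤ n) {a : Fin n → ℝ} (ha : ∀ i, 0 ≤ a i) :
    intrinsicVolume k (box a) = 2 ^ k * elemSymm k a := by
  have hP : IsSteinerPolynomial (box a) (∑ S : Finset (Fin n), Polynomial.C
      ((∏ i ∈ S, (2 * a i)) * unitBallVolume (n - S.card)) * Polynomial.X ^ (n - S.card)) := by
    intro r hr
    rw [measureReal_def, volume_box_add_closedBall ha hr, ENNReal.toReal_ofReal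
      (Finset.sum_nonneg fun S _ => mul_nonneg (mul_nonneg (Finset.prod_nonneg fun i _ =>
        mul_nonneg zero_le_two (ha i)) (unitBallVolume_pos _).le) (pow_nonneg hr _)),
      Polynomial.eval_finsetSum]
    simp only [Polynomial.eval_mul, Polynomial.eval_C, Polynomial.eval_pow, Polynomial.eval_X]
  rw [intrinsicVolume_eq k hP, div_eq_iff (unitBallVolume_pos _).ne', Polynomial.finsetSum_coeff,
    elemSymm, Finset.mul_sum, Finset.sum_mul]
  have hS : Finset.powersetCard k (Finset.univ : Finset (Fin n)) =
      Finset.univ.filter fun S => S.card = k := by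
    ext S
    simp [Finset.mem_powersetCard]
  rw [hS, Finset.sum_filter]
  refine Finset.sum_congr rfl fun S _ => ?_
  rw [Polynomial.coeff_C_mul, Polynomial.coeff_X_pow]
  -- Subtraction is truncated: equal exponents `n - |S|` and `n - k` force `|S| = k` only because
  -- neither exceeds `n`.
  have hSn : S.card ≤ n := by simpa using S.card_le_univ
  by_cases h : S.card = k
  · rw [if_pos h, if_pos (by rw [h]), h, Finset.prod_mul_distrib, Finset.prod_const, h, mul_one]
  · rw [if_neg h, if_neg (by omega), mul_zero]

/-! ### Power means. -/

/-- The power mean of exponent `p` of two numbers, with equal weights. -/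
def powerMean (p u v : ℝ) : ℝ := ((1 - 1 / 2) * u ^ p + 1 / 2 * v ^ p) ^ (1 / p)

theorem powerMean_nonneg {p u v : ℝ} (hu : 0 ≤ u) (hv : 0 ≤ v) : 0 ≤ powerMean p u v := by
  unfold powerMean
  positivity

theorem powerMean_mul_right {p u v c : ℝ} (hp : 0 < p) (hu : 0 ≤ u) (hv : 0 ≤ v) (hc : 0 ≤ c) :
    powerMean p (u * c) (v * c) = powerMean p u v * c := by
  unfold powerMean
  rw [Real.mul_rpow hu hc, Real.mul_rpow hv hc, ← mul_assoc, ← mul_assoc, ← add_mul,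
    Real.mul_rpow (by positivity) (by positivity), ← Real.rpow_mul hc, mul_one_div_cancel hp.ne',
    Real.rpow_one]

theorem powerMean_self {p u : ℝ} (hp : 0 < p) (hu : 0 ≤ u) : powerMean p u u = u := by
  rw [powerMean, ← add_mul, sub_add_cancel, one_mul, ← Real.rpow_mul hu,
    mul_one_div_cancel hp.ne', Real.rpow_one]

theorem powerMean_zero_right {p u : ℝ} (hp : 0 < p) (hu : 0 ≤ u) :
    powerMean p u 0 = 2⁻¹ ^ (1 / p) * u := by
  rw [powerMean, Real.zero_rpow hp.ne', mul_zero, add_zero,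
    Real.mul_rpow (by norm_num) (by positivity), ← Real.rpow_mul hu, mul_one_div_cancel hp.ne',
    Real.rpow_one]
  norm_num

theorem powerMean_zero_left {p u : ℝ} (hp : 0 < p) (hu : 0 ≤ u) :
    powerMean p 0 u = 2⁻¹ ^ (1 / p) * u := by
  rw [← powerMean_zero_right hp hu]
  unfold powerMean
  ring_nf

theorem powerMean_mono_exponent {p q u v : ℝ} (hq : 0 < q) (hqp : q ≤ p) (hu : 0 ≤ u)
    (hv : 0 ≤ v) : powerMean q u v ≤ powerMean p u v := by
  have hp := hq.trans_le hqp
  -- Jensen for the convex power `p / q ≥ 1`, applied to `u^q` and `v^q`.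
  have h := Real.rpow_arith_mean_le_arith_mean_rpow (Finset.univ : Finset (Fin 2))
    ![1 - 1 / 2, 1 / 2] ![u ^ q, v ^ q] (by intro i _; fin_cases i <;> norm_num)
    (by norm_num) (by intro i _; fin_cases i <;> simp <;> positivity) ((one_le_div hq).2 hqp)
  simp only [Fin.sum_univ_two, Matrix.cons_val_zero, Matrix.cons_val_one] at h
  rw [← Real.rpow_mul hu, ← Real.rpow_mul hv, mul_div_cancel₀ _ hq.ne'] at h
  have h' := Real.rpow_le_rpow (by positivity) h (one_div_pos.2 hp).le
  rw [← Real.rpow_mul (by positivity)] at h'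
  unfold powerMean
  convert h' using 2
  field_simp

theorem continuous_powerMean_add {p : ℝ} (hp : 0 < p) (u v : ℝ) :
    Continuous fun ε : ℝ => powerMean p (u + ε) (v + ε) := by
  unfold powerMean
  have h1 := Real.continuous_rpow_const hp.le
  have h2 := Real.continuous_rpow_const (one_div_pos.2 hp).le
  fun_prop

/-- The reverse Minkowski inequality for exponents at most `1`. -/
theorem sum_powerMean_le {ι : Type*} (s : Finset ι) {p : ℝ} (hp : 0 < p) (hp1 : p ≤ 1)
    {u v : ι → ℝ} (hu : ∀ i, 0 ≤ u i) (hv : ∀ i, 0 ≤ v i) :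
    ∑ i ∈ s, powerMean p (u i) (v i) ≤ powerMean p (∑ i ∈ s, u i) (∑ i ∈ s, v i) := by
  -- Minkowski in `ℓ^(1/p)`, where `1/p ≥ 1`, for the vectors `u_i^p / 2` and `v_i^p / 2`.
  have h := Real.Lp_add_le_of_nonneg s (p := 1 / p) (f := fun i => (1 - 1 / 2) * u i ^ p)
    (g := fun i => 1 / 2 * v i ^ p) (by rwa [le_div_iff₀ hp, one_mul])
    (fun i _ => by have := hu i; positivity) (fun i _ => by have := hv i; positivity)
  have key : ∀ (c : ℝ) (f : ι → ℝ), 0 ≤ c → (∀ i, 0 ≤ f i) →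
      (∑ i ∈ s, (c * f i ^ p) ^ (1 / p)) ^ (1 / (1 / p)) = c * (∑ i ∈ s, f i) ^ p := by
    intro c f hc hf
    have : ∀ i ∈ s, (c * f i ^ p) ^ (1 / p) = c ^ (1 / p) * f i := fun i _ => by
      rw [Real.mul_rpow hc (Real.rpow_nonneg (hf i) _), ← Real.rpow_mul (hf i),
        mul_one_div_cancel hp.ne', Real.rpow_one]
    rw [Finset.sum_congr rfl this, ← Finset.mul_sum, one_div_one_div,
      Real.mul_rpow (by positivity) (Finset.sum_nonneg fun i _ => hf i), ← Real.rpow_mul hc,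
      one_div_mul_cancel hp.ne', Real.rpow_one]
  rw [key _ u (by norm_num) hu, key _ v (by norm_num) hv, one_div_one_div] at h
  have hnn : 0 ≤ ∑ i ∈ s, powerMean p (u i) (v i) :=
    Finset.sum_nonneg fun i _ => powerMean_nonneg (hu i) (hv i)
  have h' := Real.rpow_le_rpow (Real.rpow_nonneg hnn p) h (one_div_pos.2 hp).le
  rwa [← Real.rpow_mul hnn, mul_one_div_cancel hp.ne', Real.rpow_one] at h'

/-! ### Reduction to elementary symmetric polynomials. -/

theorem supportFun_box {n : ℕ} {a : Fin n → ℝ} (ha : ∀ i, 0 ≤ a i)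
    (y : EuclideanSpace ℝ (Fin n)) : supportFun (box a) y = ∑ i, a i * |y i| := by
  -- The maximiser takes the sign of `y_i` in each coordinate; the value `0` at `y_i = 0` is
  -- harmless.
  refine IsGreatest.csSup_eq ⟨⟨WithLp.toLp 2 fun i => a i * SignType.sign (y i), ?_, ?_⟩, ?_⟩
  · intro i
    show |a i * SignType.sign (y i)| ≤ a i
    rcases lt_trichotomy (y i) 0 with h | h | h <;> simp [h, ha i, abs_of_nonneg]
  · simp only [PiLp.inner_apply]
    refine Finset.sum_congr rfl fun i _ => ?_
    simp only [RCLike.inner_apply, conj_trivial]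
    rw [mul_comm, mul_assoc, sign_mul_self]
  · rintro _ ⟨x, hx, rfl⟩
    simp only [PiLp.inner_apply]
    refine Finset.sum_le_sum fun i _ => ?_
    simp only [RCLike.inner_apply, conj_trivial]
    calc y i * x i ≤ |y i * x i| := le_abs_self _
      _ = |x i| * |y i| := by rw [abs_mul, mul_comm]
      _ ≤ a i * |y i| := by gcongr; exact hx i

/-- The directions `±e_i` already confine the Wulff shape to the box; the reverse Minkowski
inequality shows that no other direction cuts it further. -/
theorem pCombination_box {n : ℕ} {p : ℝ} (hp : 0 < p) (hp1 : p ≤ 1) {a b : Fin n → ℝ}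
    (ha : ∀ i, 0 ≤ a i) (hb : ∀ i, 0 ≤ b i) :
    pCombination p (1 / 2) (box a) (box b) = box fun i => powerMean p (a i) (b i) := by
  ext x
  simp only [pCombination, wulffShape, Set.mem_ofPred_eq, supportFun_box ha, supportFun_box hb]
  -- Definitional, because `powerMean` keeps the weight in the form `1 - 1 / 2`.
  change (∀ y : EuclideanSpace ℝ (Fin n), ‖y‖ = 1 → inner ℝ x y ≤
    powerMean p (∑ i, a i * |y i|) (∑ i, b i * |y i|)) ↔ _
  constructor
  · intro h i
    rw [abs_le']
    constructor
    · simpa [Pi.single_apply, apply_ite abs, EuclideanSpace.inner_single_right] using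
        h (EuclideanSpace.single i 1) (by simp)
    · simpa [Pi.single_apply, apply_ite abs, EuclideanSpace.inner_single_right] using
        h (EuclideanSpace.single i (-1)) (by simp)
  · intro h y _
    refine le_trans ?_ (sum_powerMean_le Finset.univ hp hp1
      (fun i => mul_nonneg (ha i) (abs_nonneg _)) fun i => mul_nonneg (hb i) (abs_nonneg _))
    simp only [PiLp.inner_apply]
    refine Finset.sum_le_sum fun i _ => ?_
    rw [powerMean_mul_right hp (ha i) (hb i) (abs_nonneg _)]
    simp only [RCLike.inner_apply, conj_trivial]
    calc y i * x i ≤ |y i * x i| := le_abs_self _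
      _ = |x i| * |y i| := by rw [abs_mul, mul_comm]
      _ ≤ _ := by gcongr; exact h i

theorem elemSymm_mono {n k : ℕ} {a b : Fin n → ℝ} (ha : ∀ i, 0 ≤ a i) (hab : ∀ i, a i ≤ b i) :
    elemSymm k a ≤ elemSymm k b :=
  Finset.sum_le_sum fun _ _ => Finset.prod_le_prod (fun i _ => ha i) fun i _ => hab i

theorem elemSymm_nonneg {n k : ℕ} {a : Fin n → ℝ} (ha : ∀ i, 0 ≤ a i) : 0 ≤ elemSymm k a :=
  Finset.sum_nonneg fun _ _ => Finset.prod_nonneg fun i _ => ha i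

theorem prod_le_elemSymm {n : ℕ} {a : Fin n → ℝ} (ha : ∀ i, 0 ≤ a i) (S : Finset (Fin n)) :
    ∏ i ∈ S, a i ≤ elemSymm S.card a :=
  Finset.single_le_sum (f := fun S => ∏ i ∈ S, a i)
    (fun _ _ => Finset.prod_nonneg fun i _ => ha i) (by simp [Finset.mem_powersetCard])

/-- Beating both `V_k(K₀)` and `V_k(K₁)` from below beats the mean of their `q/k`-th powers. -/
theorem violatesPBM_box {n k : ℕ} (hk : 0 < k) (hkn : k ≤ n) {p q : ℝ} (hq : 0 < q) (hqp : q ≤ p)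
    (hp1 : p ≤ 1) {a b : Fin n → ℝ} (ha : ∀ i, 0 ≤ a i) (hb : ∀ i, 0 ≤ b i)
    (h₁ : elemSymm k (fun i => powerMean p (a i) (b i)) < elemSymm k a)
    (h₂ : elemSymm k (fun i => powerMean p (a i) (b i)) < elemSymm k b) :
    ViolatesPBM k q (box a) (box b) := by
  have hM : ∀ i, 0 ≤ powerMean q (a i) (b i) := fun i => powerMean_nonneg (ha i) (hb i)
  have hmono : elemSymm k (fun i => powerMean q (a i) (b i)) ≤
      elemSymm k (fun i => powerMean p (a i) (b i)) :=
    elemSymm_mono hM fun i => powerMean_mono_exponent hq hqp (ha i) (hb i)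
  rw [ViolatesPBM, pCombination_box hq (hqp.trans hp1) ha hb, intrinsicVolume_box hkn ha,
    intrinsicVolume_box hkn hb, intrinsicVolume_box hkn hM]
  have hexp : 0 < q / k := div_pos hq (Nat.cast_pos.2 hk)
  have hnn : 0 ≤ 2 ^ k * elemSymm k (fun i => powerMean q (a i) (b i)) :=
    mul_nonneg (by positivity) (elemSymm_nonneg hM)
  have e₁ := Real.rpow_lt_rpow hnn
    (mul_lt_mul_of_pos_left (hmono.trans_lt h₁) (by positivity : (0 : ℝ) < 2 ^ k)) hexp
  have e₂ := Real.rpow_lt_rpow hnn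
    (mul_lt_mul_of_pos_left (hmono.trans_lt h₂) (by positivity : (0 : ℝ) < 2 ^ k)) hexp
  linarith

theorem isCompact_box {n : ℕ} (a : Fin n → ℝ) : IsCompact (box a) := by
  have h := (isCompact_univ_pi fun i => isCompact_Icc (a := -a i) (b := a i)).image
    (PiLp.continuous_toLp 2 fun _ : Fin n => ℝ)
  convert h
  ext x
  constructor
  · exact fun hx => ⟨x.ofLp, fun i _ => abs_le.1 (hx i), rfl⟩
  · rintro ⟨y, hy, rfl⟩ i
    exact abs_le.2 (hy i trivial)

theorem convex_box {n : ℕ} (a : Fin n → ℝ) : Convex ℝ (box a) := by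
  intro x hx y hy s t hs ht hst i
  have h1 := abs_le.1 (hx i)
  have h2 := abs_le.1 (hy i)
  simp only [PiLp.add_apply, PiLp.smul_apply, smul_eq_mul]
  obtain rfl : t = 1 - s := by linarith
  rw [abs_le]
  constructor <;> nlinarith

theorem zero_mem_box {n : ℕ} {a : Fin n → ℝ} (ha : ∀ i, 0 ≤ a i) : 0 ∈ box a :=
  fun i => by simpa using ha i

theorem zero_mem_interior_box {n : ℕ} {a : Fin n → ℝ} (ha : ∀ i, 0 < a i) :
    0 ∈ interior (box a) := by
  rw [mem_interior_iff_mem_nhds]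
  refine Filter.eventually_all.2 fun i => ?_
  have hc : Continuous fun x : EuclideanSpace ℝ (Fin n) => |x i| := by fun_prop
  exact (hc.tendsto 0).eventually (ge_mem_nhds (by simpa using ha i))

/-- Strict failure for possibly degenerate boxes is inherited by nearby full-dimensional ones. -/
theorem exists_symmetricBody_violatesPBM {n k : ℕ} (hk : 0 < k) (hkn : k ≤ n) {p : ℝ} (hp : 0 < p)
    (hp1 : p ≤ 1) {a b : Fin n → ℝ} (ha : ∀ i, 0 ≤ a i) (hb : ∀ i, 0 ≤ b i)
    (h₁ : elemSymm k (fun i => powerMean p (a i) (b i)) < elemSymm k a)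
    (h₂ : elemSymm k (fun i => powerMean p (a i) (b i)) < elemSymm k b) :
    ∃ K₀ K₁ : ConvexBody (EuclideanSpace ℝ (Fin n)),
      IsSymmetricBody K₀ ∧ IsSymmetricBody K₁ ∧ ∀ q ∈ Set.Ioc (0 : ℝ) p, ViolatesPBM k q
        (K₀ : Set (EuclideanSpace ℝ (Fin n))) (K₁ : Set (EuclideanSpace ℝ (Fin n))) := by
  -- Every half-width is enlarged by `ε`. Only the combination needs continuity, since `e_k` of the
  -- two boxes can only grow.
  have hc : Continuous fun ε : ℝ => elemSymm k fun i => powerMean p (a i + ε) (b i + ε) :=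
    continuous_finsetSum _ fun S _ => continuous_finsetProd _ fun i _ =>
      continuous_powerMean_add hp (a i) (b i)
  have hlim : Filter.Tendsto (fun ε : ℝ => elemSymm k fun i => powerMean p (a i + ε) (b i + ε))
      (nhdsWithin 0 (Set.Ioi 0)) (nhds (elemSymm k fun i => powerMean p (a i) (b i))) := by
    simpa using (hc.tendsto 0).mono_left nhdsWithin_le_nhds
  obtain ⟨ε, ⟨hε₁, hε₂⟩, hε⟩ := ((hlim.eventually_lt_const h₁).and
    (hlim.eventually_lt_const h₂) |>.and self_mem_nhdsWithin).exists
  have hε : 0 < ε := hε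
  have ha' : ∀ i, 0 < a i + ε := fun i => add_pos_of_nonneg_of_pos (ha i) hε
  have hb' : ∀ i, 0 < b i + ε := fun i => add_pos_of_nonneg_of_pos (hb i) hε
  refine ⟨⟨box fun i => a i + ε, convex_box _, isCompact_box _,
      ⟨0, zero_mem_box fun i => (ha' i).le⟩⟩,
    ⟨box fun i => b i + ε, convex_box _, isCompact_box _, ⟨0, zero_mem_box fun i => (hb' i).le⟩⟩,
    ⟨zero_mem_interior_box ha', fun x hx i => ?_⟩, ⟨zero_mem_interior_box hb', fun x hx i => ?_⟩,
    fun q hq => ?_⟩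
  · simpa using hx i
  · simpa using hx i
  · exact violatesPBM_box hk hkn hq.1 hq.2 hp1 (fun i => (ha' i).le) (fun i => (hb' i).le)
      (hε₁.trans_le (elemSymm_mono ha fun i => by linarith))
      (hε₂.trans_le (elemSymm_mono hb fun i => by linarith))

/-! ### Counting bounds for two-valued radii. -/

theorem card_filter_fin_Ico {n l u : ℕ} (hu : u ≤ n) :
    (Finset.univ.filter fun i : Fin n => l ≤ (i : ℕ) ∧ (i : ℕ) < u).card = u - l := by
  rw [Finset.card_filter, Fin.sum_univ_eq_sum_range (fun i => if l ≤ i ∧ i < u then 1 else 0) n,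
    ← Finset.card_filter, ← Nat.card_Ico]
  congr 1
  ext i
  simp only [Finset.mem_filter, Finset.mem_range, Finset.mem_Ico]
  omega

theorem elemSymm_indicator {n : ℕ} (k : ℕ) (T : Finset (Fin n)) (t : ℝ) :
    elemSymm k (fun i => if i ∈ T then t else 0) = (T.card.choose k : ℝ) * t ^ k := by
  rw [elemSymm, ← Finset.sum_subset (Finset.powersetCard_mono T.subset_univ),
    Finset.sum_congr rfl (g := fun _ => t ^ k), Finset.sum_const, Finset.card_powersetCard,
    nsmul_eq_mul]
  · intro S hS
    rw [Finset.mem_powersetCard] at hS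
    rw [← hS.2, ← Finset.prod_const]
    exact Finset.prod_congr rfl fun i hi => if_pos (hS.1 hi)
  · intro S hS hST
    rw [Finset.mem_powersetCard] at hS hST
    obtain ⟨i, hi, hiT⟩ := Finset.not_subset.1 fun h => hST ⟨h, hS.2⟩
    exact Finset.prod_eq_zero hi (if_neg hiT)

theorem prod_ite_one_const {ι : Type*} [DecidableEq ι] (S C : Finset ι) (t : ℝ) :
    ∏ i ∈ S, (if i ∈ C then 1 else t) = t ^ (S \ C).card := by
  rw [Finset.prod_ite, Finset.prod_const_one, one_mul, Finset.prod_const,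
    Finset.sdiff_eq_filter]

/-- A `k`-set cannot fit inside `C`, so every product contains at least one factor `t`. -/
theorem elemSymm_ite_one_le {n k : ℕ} (C : Finset (Fin n)) (hC : C.card < k) {t : ℝ} (ht : 0 ≤ t)
    (ht1 : t ≤ 1) : elemSymm k (fun i => if i ∈ C then 1 else t) ≤ (n.choose k : ℝ) * t := by
  refine (Finset.sum_le_card_nsmul _ _ t fun S hS => ?_).trans_eq (by simp)
  rw [prod_ite_one_const]
  refine pow_le_of_le_one ht ht1 ?_
  have := Finset.le_card_sdiff C S
  have := (Finset.mem_powersetCard.1 hS).2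
  omega

/-- A `k`-set has at least `k - |C|` elements outside `C`, with equality exactly when it contains
`C`. Such sets are determined by their part outside `C`, which gives the leading coefficient; all
others carry an extra factor `t`. -/
theorem elemSymm_ite_one_le_leading_add {n k : ℕ} (C : Finset (Fin n)) (hC : C.card ≤ k) {t : ℝ}
    (ht : 0 ≤ t) (ht1 : t ≤ 1) :
    elemSymm k (fun i => if i ∈ C then 1 else t) ≤
      ((n - C.card).choose (k - C.card) : ℝ) * t ^ (k - C.card) +
        (n.choose k : ℝ) * t ^ (k - C.card + 1) := by
  set m := k - C.card with hm
  have hterm : ∀ S ∈ Finset.powersetCard k (Finset.univ : Finset (Fin n)),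
      ∏ i ∈ S, (if i ∈ C then 1 else t) ≤
        (if (S \ C).card = m then t ^ m else 0) + t ^ (m + 1) := by
    intro S hS
    rw [prod_ite_one_const]
    split_ifs with h
    · rw [h]
      exact le_add_of_nonneg_right (by positivity)
    · rw [zero_add]
      refine pow_le_pow_of_le_one ht ht1 ?_
      have := Finset.le_card_sdiff C S
      have := (Finset.mem_powersetCard.1 hS).2
      omega
  refine (Finset.sum_le_sum hterm).trans ?_
  rw [Finset.sum_add_distrib, ← Finset.sum_filter, Finset.sum_const, Finset.sum_const,
    Finset.card_powersetCard, Finset.card_univ, Fintype.card_fin, nsmul_eq_mul, nsmul_eq_mul]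
  gcongr
  have hcompl : n - C.card = Cᶜ.card := by rw [Finset.card_compl, Fintype.card_fin]
  rw [hcompl, ← Finset.card_powersetCard]
  have hsub : ∀ S : Finset (Fin n), S.card = k → (S \ C).card = m → C ⊆ S := fun S hS hSm => by
    have h := Finset.card_sdiff_add_card_inter S C
    have : S ∩ C = C := Finset.eq_of_subset_of_card_le Finset.inter_subset_right (by omega)
    exact Finset.inter_eq_right.1 this
  refine Finset.card_le_card_of_injOn (· \ C) (fun S hS => ?_) fun S hS S' hS' h => ?_
  · simp only [Finset.coe_filter, Finset.mem_powersetCard, Set.mem_ofPred_eq] at hS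
    simp only [Finset.mem_coe, Finset.mem_powersetCard]
    exact ⟨fun i hi => Finset.mem_compl.2 (Finset.mem_sdiff.1 hi).2, hS.2⟩
  · simp only [Finset.coe_filter, Finset.mem_powersetCard, Set.mem_ofPred_eq] at hS hS'
    rw [← Finset.sdiff_union_of_subset (hsub S hS.1.2 hS.2),
      ← Finset.sdiff_union_of_subset (hsub S' hS'.1.2 hS'.2)]
    exact congrArg (· ∪ C) h

/-! ### The test boxes. -/

/-- Half-widths of a box in the span of the last `k` coordinates: `1` in the coordinates shared with
the first `k`, and `δ` in the others. -/
def lastRadii (n k : ℕ) (δ : ℝ) (i : Fin n) : ℝ :=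
  if (i : ℕ) < n - k then 0 else if (i : ℕ) < k then 1 else δ

/-- Half-widths of a box in the span of the first `k` coordinates: `1` in the coordinates shared
with the last `k`, and `δ` in the others. -/
def firstRadii (n k : ℕ) (δ : ℝ) (i : Fin n) : ℝ :=
  if k ≤ (i : ℕ) then 0 else if n - k ≤ (i : ℕ) then 1 else δ

theorem lastRadii_nonneg {n k : ℕ} {δ : ℝ} (hδ : 0 ≤ δ) (i : Fin n) : 0 ≤ lastRadii n k δ i := by
  unfold lastRadii
  split_ifs <;> simp [hδ]

theorem firstRadii_nonneg {n k : ℕ} {δ : ℝ} (hδ : 0 ≤ δ) (i : Fin n) :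
    0 ≤ firstRadii n k δ i := by
  unfold firstRadii
  split_ifs <;> simp [hδ]

theorem lastCube_eq_box (n k : ℕ) : lastCube n k = box (lastRadii n k 1) := by
  ext x
  refine forall_congr' fun i => ?_
  unfold lastRadii
  by_cases h : (i : ℕ) < n - k
  · simp only [h, not_le.2 h, if_true, forall_const, false_imp_iff, and_true, abs_nonpos_iff]
  · simp [h, not_lt.1 h]

theorem firstCube_eq_box (n k : ℕ) : firstCube n k = box (firstRadii n k 1) := by
  ext x
  refine forall_congr' fun i => ?_
  unfold firstRadii
  by_cases h : k ≤ (i : ℕ)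
  · simp [h, abs_nonpos_iff]
  · simp [h, not_le.1 h]

theorem one_le_elemSymm_lastRadii {n k : ℕ} (hk : k ≤ n) : 1 ≤ elemSymm k (lastRadii n k 1) := by
  have h := prod_le_elemSymm (lastRadii_nonneg (n := n) (k := k) zero_le_one)
    (Finset.univ.filter fun i : Fin n => n - k ≤ (i : ℕ) ∧ (i : ℕ) < n)
  rw [card_filter_fin_Ico le_rfl, Nat.sub_sub_self hk, Finset.prod_eq_one] at h
  · exact h
  · intro i hi
    simp [lastRadii, (Finset.mem_filter.1 hi).2.1]

theorem one_le_elemSymm_firstRadii {n k : ℕ} (hk : k ≤ n) :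
    1 ≤ elemSymm k (firstRadii n k 1) := by
  have h := prod_le_elemSymm (firstRadii_nonneg (n := n) (k := k) zero_le_one)
    (Finset.univ.filter fun i : Fin n => 0 ≤ (i : ℕ) ∧ (i : ℕ) < k)
  rw [card_filter_fin_Ico hk, Nat.sub_zero, Finset.prod_eq_one] at h
  · exact h
  · intro i hi
    simp [firstRadii, (Finset.mem_filter.1 hi).2.2]

theorem pow_le_elemSymm_lastRadii {n k : ℕ} (hk : k ≤ n) (hkn : n < 2 * k) {δ : ℝ} (hδ : 0 ≤ δ) :
    δ ^ (n - k) ≤ elemSymm k (lastRadii n k δ) := by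
  have h := prod_le_elemSymm (lastRadii_nonneg (n := n) (k := k) hδ)
    (Finset.univ.filter fun i : Fin n => n - k ≤ (i : ℕ) ∧ (i : ℕ) < n)
  rw [card_filter_fin_Ico le_rfl, Nat.sub_sub_self hk] at h
  refine le_of_eq_of_le ?_ h
  rw [Finset.prod_congr rfl (g := fun i => if i ∈ Finset.univ.filter
      (fun i : Fin n => 0 ≤ (i : ℕ) ∧ (i : ℕ) < k) then 1 else δ),
    prod_ite_one_const]
  · refine congrArg (δ ^ ·) ((Eq.trans (congrArg Finset.card ?_)
      (card_filter_fin_Ico (l := k) (le_refl n))).symm)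
    ext i
    simp only [Finset.mem_filter, Finset.mem_sdiff, Finset.mem_univ, true_and]
    omega
  · intro i hi
    simp [lastRadii, (Finset.mem_filter.1 hi).2.1]

theorem pow_le_elemSymm_firstRadii {n k : ℕ} (hk : k ≤ n) (hkn : n < 2 * k) {δ : ℝ}
    (hδ : 0 ≤ δ) : δ ^ (n - k) ≤ elemSymm k (firstRadii n k δ) := by
  have h := prod_le_elemSymm (firstRadii_nonneg (n := n) (k := k) hδ)
    (Finset.univ.filter fun i : Fin n => 0 ≤ (i : ℕ) ∧ (i : ℕ) < k)
  rw [card_filter_fin_Ico hk, Nat.sub_zero] at h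
  refine le_of_eq_of_le ?_ h
  rw [Finset.prod_congr rfl (g := fun i => if i ∈ Finset.univ.filter
      (fun i : Fin n => n - k ≤ (i : ℕ) ∧ (i : ℕ) < n) then 1 else δ),
    prod_ite_one_const]
  · refine congrArg (δ ^ ·) ((Eq.trans (congrArg Finset.card ?_)
      (card_filter_fin_Ico (n := n) (l := 0) (u := n - k) (by omega))).symm)
    ext i
    simp only [Finset.mem_filter, Finset.mem_sdiff, Finset.mem_univ, true_and]
    omega
  · intro i hi
    simp [firstRadii, (Finset.mem_filter.1 hi).2.2]

/-- As `n < 2k`, no coordinate is missing from both boxes: it is shared, or `δ` is averaged with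
`0`. -/
theorem powerMean_radii_of_lt {n k : ℕ} (hkn : n < 2 * k) {p δ : ℝ} (hp : 0 < p) (hδ : 0 ≤ δ)
    (i : Fin n) :
    powerMean p (lastRadii n k δ i) (firstRadii n k δ i) =
      if i ∈ Finset.univ.filter (fun i : Fin n => n - k ≤ (i : ℕ) ∧ (i : ℕ) < k) then 1
      else 2⁻¹ ^ (1 / p) * δ := by
  unfold lastRadii firstRadii
  simp only [Finset.mem_filter, Finset.mem_univ, true_and]
  by_cases h1 : (i : ℕ) < n - k
  · have h2 : ¬ k ≤ (i : ℕ) := by omega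
    simp only [h1, h2, not_le.2 h1, if_true, if_false, false_and]
    exact powerMean_zero_left hp hδ
  · by_cases h2 : k ≤ (i : ℕ)
    · simp only [h1, h2, not_lt.2 h2, if_true, if_false, and_false]
      exact powerMean_zero_right hp hδ
    · simp only [h1, h2, not_lt.1 h1, not_le.1 h2, if_true, if_false, and_self]
      exact powerMean_self hp zero_le_one

theorem powerMean_radii_of_le {n k : ℕ} (hkn : 2 * k ≤ n) {p : ℝ} (hp : 0 < p) (i : Fin n) :
    powerMean p (lastRadii n k 1 i) (firstRadii n k 1 i) =
      if i ∈ Finset.univ.filter (fun i : Fin n => 0 ≤ (i : ℕ) ∧ (i : ℕ) < k) ∪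
        Finset.univ.filter (fun i : Fin n => n - k ≤ (i : ℕ) ∧ (i : ℕ) < n)
      then 2⁻¹ ^ (1 / p) else 0 := by
  unfold lastRadii firstRadii
  simp only [Finset.mem_union, Finset.mem_filter, Finset.mem_univ, true_and, ite_self, i.2,
    and_true, zero_le]
  by_cases h1 : (i : ℕ) < n - k
  · by_cases h2 : k ≤ (i : ℕ)
    · simp only [h1, h2, not_le.2 h1, not_lt.2 h2, if_true, if_false, or_self]
      exact powerMean_self hp le_rfl
    · simp only [h1, h2, not_le.1 h2, if_true, if_false, true_or]
      rw [powerMean_zero_left hp zero_le_one, mul_one]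
  · have h2 : k ≤ (i : ℕ) := by omega
    simp only [h1, h2, not_lt.1 h1, if_true, if_false, or_true]
    rw [powerMean_zero_right hp zero_le_one, mul_one]

theorem elemSymm_powerMean_cube_of_le {n k : ℕ} (hkn : 2 * k ≤ n) {p : ℝ} (hp : 0 < p) :
    elemSymm k (fun i => powerMean p (lastRadii n k 1 i) (firstRadii n k 1 i)) ≤
      ((2 * k).choose k : ℝ) * (2⁻¹ ^ (1 / p)) ^ k := by
  simp only [powerMean_radii_of_le hkn hp]
  rw [elemSymm_indicator]
  gcongr
  refine (Finset.card_union_le _ _).trans ?_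
  rw [card_filter_fin_Ico (by omega), card_filter_fin_Ico le_rfl]
  omega

theorem rpow_half_le_one {p : ℝ} (hp : 0 < p) : (2⁻¹ : ℝ) ^ (1 / p) ≤ 1 :=
  Real.rpow_le_one (by norm_num) (by norm_num) (one_div_pos.2 hp).le

theorem elemSymm_powerMean_cube_of_lt {n k : ℕ} (hk : k < n) (hkn : n < 2 * k) {p : ℝ}
    (hp : 0 < p) :
    elemSymm k (fun i => powerMean p (lastRadii n k 1 i) (firstRadii n k 1 i)) ≤
      (n.choose k : ℝ) * 2⁻¹ ^ (1 / p) := by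
  simp only [powerMean_radii_of_lt hkn hp zero_le_one, mul_one]
  refine elemSymm_ite_one_le _ ?_ (by positivity) (rpow_half_le_one hp)
  rw [card_filter_fin_Ico hk.le]
  omega

/-- Leading-order bound in `δ`: the shared block has `2k - n` elements, leaving `2(n - k)`
coordinates of which `n - k` must be chosen. -/
theorem elemSymm_powerMean_radii_le {n k : ℕ} (hk : k ≤ n) (hkn : n < 2 * k) {p δ : ℝ}
    (hp : 0 < p) (hδ : 0 ≤ δ) (hδ1 : δ ≤ 1) :
    elemSymm k (fun i => powerMean p (lastRadii n k δ i) (firstRadii n k δ i)) ≤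
      (((2 * (n - k)).choose (n - k) : ℝ) * (2⁻¹ ^ (1 / p)) ^ (n - k) + n.choose k * δ) *
        δ ^ (n - k) := by
  have hs := rpow_half_le_one hp
  have hs0 : (0 : ℝ) ≤ 2⁻¹ ^ (1 / p) := by positivity
  simp only [powerMean_radii_of_lt hkn hp hδ]
  generalize (2⁻¹ : ℝ) ^ (1 / p) = s at hs hs0
  have hC : (Finset.univ.filter fun i : Fin n => n - k ≤ (i : ℕ) ∧ (i : ℕ) < k).card =
    k - (n - k) := card_filter_fin_Ico hk
  refine (elemSymm_ite_one_le_leading_add _ (by omega) (mul_nonneg hs0 hδ)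
    (mul_le_one₀ hs hδ hδ1)).trans ?_
  rw [hC, show n - (k - (n - k)) = 2 * (n - k) by omega, Nat.sub_sub_self (by omega), add_mul,
    mul_pow, mul_pow, pow_succ δ, mul_assoc]
  have : s ^ (n - k + 1) ≤ 1 := pow_le_one₀ hs0 hs
  have h2 : s ^ (n - k + 1) * (δ ^ (n - k) * δ) ≤ 1 * (δ ^ (n - k) * δ) := by gcongr
  have h3 := mul_le_mul_of_nonneg_left h2 (Nat.cast_nonneg (α := ℝ) (n.choose k))
  linarith

/-! ### The thresholds. -/

theorem mul_rpow_half_pow_lt_one {j : ℕ} {B p : ℝ} (hB : 1 < B) (hp : 0 < p)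
    (h : p < j / Real.logb 2 B) : B * (2⁻¹ ^ (1 / p)) ^ j < 1 := by
  have hB0 : 0 < B := one_pos.trans hB
  rw [lt_div_iff₀ (Real.logb_pos one_lt_two hB), mul_comm, ← lt_div_iff₀ hp,
    Real.logb_lt_iff_lt_rpow one_lt_two hB0] at h
  rw [Real.inv_rpow zero_le_two, inv_pow, ← Real.rpow_mul_natCast zero_le_two, ← div_eq_mul_inv,
    div_lt_one (by positivity)]
  rwa [one_div_mul_eq_div]

theorem div_logb_mem_Ioo {j : ℕ} (hj : 0 < j) {B : ℝ} (hB : 2 ^ j < B) :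
    j / Real.logb 2 B ∈ Set.Ioo (0 : ℝ) 1 := by
  have hB0 : 0 < B := lt_trans (by positivity) hB
  have hj0 : (0 : ℝ) < j := Nat.cast_pos.2 hj
  have h : (j : ℝ) < Real.logb 2 B := by
    rwa [Real.lt_logb_iff_rpow_lt one_lt_two hB0, Real.rpow_natCast]
  exact ⟨div_pos hj0 (hj0.trans h), (div_lt_one (hj0.trans h)).2 h⟩

theorem two_pow_lt_choose_two_mul {k : ℕ} (hk : 2 ≤ k) : 2 ^ k < (2 * k).choose k := by
  change 2 ^ k < k.centralBinom
  induction k, hk using Nat.le_induction with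
  | base => decide
  | succ k hk ih =>
    -- The ratio of consecutive central binomials is `2(2k+1)/(k+1) ≥ 2`.
    have h := Nat.succ_mul_centralBinom_succ k
    rw [pow_succ]
    nlinarith

/-- In the range `k > n / 2`, the threshold is `1 / log₂ N` for a large enough `N`. -/
theorem exists_pBar_eq {n k : ℕ} (hk : 2 ≤ k) (hkn : k < n) (h : n < 2 * k) :
    ∃ N : ℝ, pBar n k = 1 / Real.logb 2 N ∧ 2 < N ∧ ((2 * (n - k)).choose (n - k) : ℝ) ≤ N := by
  have hm : 1 ≤ n - k := by omega
  rw [pBar, if_neg (by omega)]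
  split_ifs with h3
  · refine ⟨_, rfl, ?_, ?_⟩
    -- The terms `i = 1, 2` already exceed `2`.
    · have := Finset.add_le_sum (s := Finset.Icc 1 k) (f := fun i => (2 * (n - k)).choose i)
        (fun _ _ => Nat.zero_le _) (i := 1) (j := 2) (by simp; omega) (by simp; omega)
        (by norm_num)
      have h2 : 0 < (2 * (n - k)).choose 2 := Nat.choose_pos (by omega)
      rw [Nat.choose_one_right] at this
      exact_mod_cast (by omega : 2 < ∑ i ∈ Finset.Icc 1 k, (2 * (n - k)).choose i)
    -- The central term `i = n - k` occurs in the sum because `n - k ≤ k`.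
    · exact Finset.single_le_sum (f := fun i => ((2 * (n - k)).choose i : ℝ))
        (fun _ _ => Nat.cast_nonneg _) (Finset.mem_Icc.2 ⟨hm, by omega⟩)
  · refine ⟨_, rfl, ?_, ?_⟩
    · have : (2 : ℝ) ^ 2 ≤ 2 ^ (2 * (n - k)) := pow_le_pow_right₀ one_le_two (by omega)
      linarith
    · have := Nat.choose_lt_two_pow (2 * (n - k)) (n - k) (by omega)
      have h' : ((2 * (n - k)).choose (n - k) : ℝ) + 1 ≤ 2 ^ (2 * (n - k)) := by
        exact_mod_cast this
      linarith

theorem pBar_mem_Ioo {n k : ℕ} (hk : 2 ≤ k) (hkn : k < n) : pBar n k ∈ Set.Ioo (0 : ℝ) 1 := by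
  by_cases h : 2 * k ≤ n
  · rw [pBar, if_pos h]
    exact div_logb_mem_Ioo (by omega) (by exact_mod_cast two_pow_lt_choose_two_mul hk)
  · obtain ⟨N, hN, hN2, -⟩ := exists_pBar_eq hk hkn (not_le.1 h)
    rw [hN]
    simpa using div_logb_mem_Ioo one_pos (by simpa using hN2)

theorem le_choose {n k : ℕ} (hk : 0 < k) (hkn : k < n) : n ≤ n.choose k := by
  obtain ⟨k, rfl⟩ : ∃ j, k = j + 1 := ⟨k - 1, by omega⟩
  induction n with
  | zero => exact absurd hkn (by omega)
  | succ n ih =>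
    rcases (Nat.lt_succ_iff.1 hkn).eq_or_lt with rfl | h
    · rw [Nat.choose_succ_self_right]
    · rw [Nat.choose_succ_succ']
      have := ih h
      have : 0 < n.choose k := Nat.choose_pos (by omega)
      omega

theorem pCube_mem_Ioo {n k : ℕ} (hn : 3 ≤ n) (hk : 2 ≤ k) (hkn : k < n) :
    pCube n k ∈ Set.Ioo (0 : ℝ) 1 := by
  by_cases h : 2 * k ≤ n
  · rw [pCube, if_pos h]
    exact pBar_mem_Ioo hk hkn
  · rw [pCube, if_neg h]
    have h2 : 2 < n.choose k := hn.trans (le_choose (by omega) hkn)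
    simpa using div_logb_mem_Ioo one_pos (B := n.choose k) (by simpa using h2)

theorem elemSymm_powerMean_cube_lt_one {n k : ℕ} (hk : 2 ≤ k) (hkn : k < n) {p : ℝ}
    (hp : 0 < p) (hpk : p < pCube n k) :
    elemSymm k (fun i => powerMean p (lastRadii n k 1 i) (firstRadii n k 1 i)) < 1 := by
  by_cases h : 2 * k ≤ n
  · rw [pCube, if_pos h, pBar, if_pos h] at hpk
    refine (elemSymm_powerMean_cube_of_le h hp).trans_lt (mul_rpow_half_pow_lt_one ?_ hp hpk)
    exact_mod_cast (Nat.one_lt_two_pow (by omega)).trans (two_pow_lt_choose_two_mul hk)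
  · rw [pCube, if_neg h] at hpk
    refine (elemSymm_powerMean_cube_of_lt hkn (not_le.1 h) hp).trans_lt ?_
    have h2 := le_choose (by omega) hkn
    simpa using mul_rpow_half_pow_lt_one (j := 1) (B := n.choose k)
      (by exact_mod_cast (by omega : 1 < n.choose k)) hp (by simpa using hpk)

theorem exists_elemSymm_powerMean_radii_lt {n k : ℕ} (hk : 2 ≤ k) (hkn : k < n) (h : n < 2 * k)
    {p : ℝ} (hp : 0 < p) (hpk : p < pBar n k) :
    ∃ δ : ℝ, 0 ≤ δ ∧
      elemSymm k (fun i => powerMean p (lastRadii n k δ i) (firstRadii n k δ i)) <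
        δ ^ (n - k) := by
  obtain ⟨N, hN, hN2, hNc⟩ := exists_pBar_eq hk hkn h
  have hNs : N * 2⁻¹ ^ (1 / p) < 1 := by
    simpa using mul_rpow_half_pow_lt_one (j := 1) (by linarith) hp (by simpa [hN] using hpk)
  have hs0 : (0 : ℝ) ≤ 2⁻¹ ^ (1 / p) := by positivity
  -- As `s ≤ 1` and `n - k ≥ 1`, `s^(n-k) ≤ s`, so the bound on `N s` suffices.
  have hlead : ((2 * (n - k)).choose (n - k) : ℝ) * (2⁻¹ ^ (1 / p)) ^ (n - k) < 1 := by
    refine lt_of_le_of_lt ?_ hNs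
    gcongr
    exact pow_le_of_le_one hs0 (rpow_half_le_one hp) (by omega)
  have hB : (0 : ℝ) < n.choose k := by exact_mod_cast Nat.choose_pos hkn.le
  -- `δ` is small enough for the error `C(n,k) δ` to fit in the slack left by `hlead`.
  obtain ⟨δ, hδ0, hδ⟩ := exists_between (lt_min one_pos (div_pos (sub_pos.2 hlead) hB))
  rw [lt_min_iff, lt_div_iff₀ hB] at hδ
  refine ⟨δ, hδ0.le, (elemSymm_powerMean_radii_le hkn.le h hp hδ0.le hδ.1.le).trans_lt ?_⟩
  exact mul_lt_of_lt_one_left (by positivity) (by linarith)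

end PBrunnMinkowski

end

theorem theorem1p4 (n k : ℕ) (hn : 3 ≤ n) (hk : 2 ≤ k) (hkn : k ≤ n - 1) :
    PBrunnMinkowski.pBar n k ∈ Set.Ioo (0 : ℝ) 1 ∧
    (∀ p ∈ Set.Ioo (0 : ℝ) (PBrunnMinkowski.pBar n k),
      ∃ K₀ K₁ : ConvexBody (EuclideanSpace ℝ (Fin n)),
        PBrunnMinkowski.IsSymmetricBody K₀ ∧ PBrunnMinkowski.IsSymmetricBody K₁ ∧
        ∀ q ∈ Set.Ioc (0 : ℝ) p,
          PBrunnMinkowski.ViolatesPBM k q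
            (K₀ : Set (EuclideanSpace ℝ (Fin n))) (K₁ : Set (EuclideanSpace ℝ (Fin n)))) ∧
    PBrunnMinkowski.pCube n k ∈ Set.Ioo (0 : ℝ) 1 ∧
    (∀ p ∈ Set.Ioo (0 : ℝ) (PBrunnMinkowski.pCube n k),
      PBrunnMinkowski.ViolatesPBM k p
        (PBrunnMinkowski.lastCube n k) (PBrunnMinkowski.firstCube n k)) := by
  open PBrunnMinkowski in
  have hk0 : 0 < k := by omega
  have hkn : k < n := by omega
  have hbar := pBar_mem_Ioo hk hkn
  have hcube := pCube_mem_Ioo hn hk hkn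
  refine ⟨hbar, fun p hp => ?_, hcube, fun p hp => ?_⟩
  · have hp1 : p ≤ 1 := (hp.2.trans hbar.2).le
    by_cases h : 2 * k ≤ n
    · have hlt := elemSymm_powerMean_cube_lt_one hk hkn hp.1 (by rw [pCube, if_pos h]; exact hp.2)
      exact exists_symmetricBody_violatesPBM hk0 hkn.le hp.1 hp1 (lastRadii_nonneg zero_le_one)
        (firstRadii_nonneg zero_le_one) (hlt.trans_le (one_le_elemSymm_lastRadii hkn.le))
        (hlt.trans_le (one_le_elemSymm_firstRadii hkn.le))
    · obtain ⟨δ, hδ, hlt⟩ := exists_elemSymm_powerMean_radii_lt hk hkn (not_le.1 h) hp.1 hp.2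
      exact exists_symmetricBody_violatesPBM hk0 hkn.le hp.1 hp1 (lastRadii_nonneg hδ)
        (firstRadii_nonneg hδ)
        (hlt.trans_le (pow_le_elemSymm_lastRadii hkn.le (not_le.1 h) hδ))
        (hlt.trans_le (pow_le_elemSymm_firstRadii hkn.le (not_le.1 h) hδ))
  · have hlt := elemSymm_powerMean_cube_lt_one hk hkn hp.1 hp.2
    rw [lastCube_eq_box, firstCube_eq_box]
    exact violatesPBM_box hk0 hkn.le hp.1 le_rfl (hp.2.trans hcube.2).le
      (lastRadii_nonneg zero_le_one) (firstRadii_nonneg zero_le_one)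
      (hlt.trans_le (one_le_elemSymm_lastRadii hkn.le))
      (hlt.trans_le (one_le_elemSymm_firstRadii hkn.le))
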